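/- Let $\Psi$ be an infinite set, and let $\mathfrak S_\Psi$ be the group of all permutations of $\Psi$, endowed with the topology generated by the left translates of the stabilizers of the elements of $\Psi$. Let $K$ be a field endowed with a faithful action of $\mathfrak S_\Psi$ by field automorphisms which is smooth, i.e. the stabilizer of every element of $K$ is open. For a subgroup $U\subseteq\mathfrak S_\Psi$, let $K\langle U\rangle$ be the skew group ring, whose elements are the finite formal sums $\sum_i a_i[g_i]$ with $a_i\in K$, $g_i\in U$, with multiplication $(a[g])(b[h])=a\,g(b)\,[gh]$. A left $K\langle U\rangle$-module (a $K$-semilinear representation of $U$) is called smooth if the stabilizer in $U$ of every vector is open in $U$; $\mathrm{Sm}_K(U)$ denotes the category of smooth left $K\langle U\rangle$-modules. Theorem. For any morphism $\varphi:M'\to M$ between smooth finitely generated left $K\langle\mathfrak S_\Psi\rangle$-modules there exist an open subgroup $U\subseteq\mathfrak S_\Psi$ and decompositions $M'=\ker\varphi\oplus M'_0$ and $M=\mathrm{Im}(\varphi)\oplus M_0$ in $\mathrm{Sm}_K(U)$. -/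

import Mathlib

universe u v w

section PermutationTopology

/-- The permutation topology on the group `𝔖_Ψ` of all permutations of a set `Ψ`: it is generated
by the left translates of the stabilizers of the elements of `Ψ`. -/
instance permTopology (Ψ : Type u) : TopologicalSpace (Equiv.Perm Ψ) :=
  TopologicalSpace.generateFrom
    {S | ∃ (σ : Equiv.Perm Ψ) (x : Ψ),
      S = (fun τ => σ * τ) '' (MulAction.stabilizer (Equiv.Perm Ψ) x : Set (Equiv.Perm Ψ))}

end PermutationTopology

section Smooth

/-- The action of a topological group `G` on a set `X` is smooth if all stabilizers are open. -/
def IsSmoothAction (G : Type u) [Group G] [TopologicalSpace G] (X : Type v) [MulAction G X] :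
    Prop :=
  ∀ x : X, IsOpen (MulAction.stabilizer G x : Set G)

/-- A left module `V` over the skew group ring `K⟨G⟩` (a `K`-semilinear representation of `G`)
is smooth if the stabilizer of every vector is open in `G`; here `g : G` acts on `V` as the
element `1 · [g]` of `K⟨G⟩`. -/
def IsSmoothModule (K : Type u) [Field K] (G : Type v) [Group G] [TopologicalSpace G]
    [MulSemiringAction G K] (V : Type w) [AddCommGroup V] [Module (SkewMonoidAlgebra K G) V] :
    Prop :=
  ∀ x : V, IsOpen {g : G | SkewMonoidAlgebra.of K G g • x = x}

end Smooth

section Restriction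

variable (K : Type u) [Field K] {G : Type v} [Group G] [MulSemiringAction G K]

/-- The natural ring homomorphism `K⟨U⟩ → K⟨G⟩`, `∑ aᵢ[uᵢ] ↦ ∑ aᵢ[uᵢ]`, for a subgroup `U`
of `G`. -/
noncomputable def skewInclusion (U : Subgroup G) :
    SkewMonoidAlgebra K U →+* SkewMonoidAlgebra K G :=
  SkewMonoidAlgebra.mapDomainRingHom (f := U.subtype) (fun (_ : U) (_ : K) => rfl)

/-- The restriction to a subgroup `U ⊆ G` of a `K`-semilinear representation `V` of `G`:
the same abelian group, considered as a `K⟨U⟩`-module. -/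
def ResSubgroup (_U : Subgroup G) (V : Type w) : Type w := V

instance (U : Subgroup G) (V : Type w) [AddCommGroup V] : AddCommGroup (ResSubgroup U V) :=
  inferInstanceAs (AddCommGroup V)

noncomputable instance (U : Subgroup G) (V : Type w) [AddCommGroup V]
    [Module (SkewMonoidAlgebra K G) V] :
    Module (SkewMonoidAlgebra K U) (ResSubgroup U V) :=
  Module.compHom V (skewInclusion K U)

variable {K}

/-- A `K⟨G⟩`-submodule, considered as a `K⟨U⟩`-submodule of the restriction to `U`. -/
def resSubmodule (U : Subgroup G) {V : Type w} [AddCommGroup V]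
    [Module (SkewMonoidAlgebra K G) V] (W : Submodule (SkewMonoidAlgebra K G) V) :
    Submodule (SkewMonoidAlgebra K U) (ResSubgroup U V) where
  carrier := {x : V | x ∈ W}
  add_mem' := fun {_ _} ha hb => W.add_mem ha hb
  zero_mem' := W.zero_mem
  smul_mem' := fun c {_} hx => W.smul_mem (skewInclusion K U c) hx

/-- For a `K⟨G⟩`-submodule `W` of `V` and a subgroup `U` of `G`: the restriction of `W` to `U` is
a direct summand of the restriction of `V` to `U` in the category `Sm_K(U)` of smooth
`K`-semilinear representations of `U`, i.e. `V = W ⊕ W'` for some `K⟨U⟩`-submodule `W'`, all of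
these being smooth representations of `U`. -/
def IsSmoothDirectSummand [TopologicalSpace G] (U : Subgroup G) {V : Type w} [AddCommGroup V]
    [Module (SkewMonoidAlgebra K G) V] (W : Submodule (SkewMonoidAlgebra K G) V) : Prop :=
  IsSmoothModule K U (ResSubgroup U V) ∧
  IsSmoothModule K U (resSubmodule U W) ∧
  ∃ W' : Submodule (SkewMonoidAlgebra K U) (ResSubgroup U V),
    IsSmoothModule K U W' ∧ IsCompl (resSubmodule U W) W'

end Restriction

/-! Both `ker φ` and `range φ` are kernels of surjections onto finitely generated modules, namely
`M' → range φ` and `M → M / range φ`. So it suffices to split such a surjection π over the pointwise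
stabilizer of every large enough finite set (`exists_forall_isSmoothDirectSummand_ker`).

The target is spanned over K by the translates of finitely many vectors, each with a finite support.
`exists_stable_lift` builds a stable subspace which π maps isomorphically onto this span, by
induction on a bound for the number of support elements outside T. The top layer is sorted by S = A
\ T with |S| = s. It is treated for one S₀ and then transported, the stabilizer being transitive on
the relevant S.

For S₀, `exists_lift_supportSpan` lifts a finite-dimensional span modulo lower generators. After
enlarging T, chosen lifts are fixed by the stabilizer of T ∪ S₀, and the remaining finite group
Sym(S₀) is handled by averaging with an element of K of trace 1. Such an element exists in every
characteristic because the action on K is faithful.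

The pieces for different S are independent: adjoining to T the points of the other supports outside
S pushes the other pieces into the lower span, while by `exists_inf_lowerSpan_le` this enlargement
creates no new relations for S. -/

/-! ### Stabilizers of finite sets in the symmetric group. -/

section PermutationGroup

variable {Ψ : Type*}

/-- The subgroup of permutations fixing every element of a finite set. -/
def pointwiseFixer (T : Finset Ψ) : Subgroup (Equiv.Perm Ψ) :=
  fixingSubgroup (Equiv.Perm Ψ) (T : Set Ψ)

theorem mem_pointwiseFixer {T : Finset Ψ} {g : Equiv.Perm Ψ} :
    g ∈ pointwiseFixer T ↔ ∀ t ∈ T, g t = t := by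
  simp [pointwiseFixer, mem_fixingSubgroup_iff]

theorem pointwiseFixer_anti {S T : Finset Ψ} (h : S ⊆ T) :
    pointwiseFixer T ≤ pointwiseFixer S := fun _ hg =>
  mem_pointwiseFixer.2 fun t ht => mem_pointwiseFixer.1 hg t (h ht)

/-- The subgroup of permutations supported on a finite set. -/
def permSupportedOn (S : Finset Ψ) : Subgroup (Equiv.Perm Ψ) :=
  fixingSubgroup (Equiv.Perm Ψ) ((S : Set Ψ)ᶜ)

theorem mem_permSupportedOn {S : Finset Ψ} {g : Equiv.Perm Ψ} :
    g ∈ permSupportedOn S ↔ ∀ x ∉ S, g x = x := by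
  simp [permSupportedOn, mem_fixingSubgroup_iff]

theorem apply_mem_of_mem_permSupportedOn {S : Finset Ψ} {g : Equiv.Perm Ψ}
    (hg : g ∈ permSupportedOn S) {x : Ψ} (hx : x ∈ S) : g x ∈ S := by
  by_contra h
  have h1 := mem_permSupportedOn.1 hg _ h
  rw [g.injective h1] at h
  exact h hx

instance finite_permSupportedOn (S : Finset Ψ) : Finite (permSupportedOn S) := by
  let e : permSupportedOn S → (S → S) :=
    fun g x => ⟨g.1 x, apply_mem_of_mem_permSupportedOn g.2 x.2⟩
  refine Finite.of_injective e fun g h hgh => Subtype.ext (Equiv.ext fun x => ?_)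
  by_cases hx : x ∈ S
  · exact congrArg Subtype.val (congrFun hgh ⟨x, hx⟩)
  · rw [mem_permSupportedOn.1 g.2 x hx, mem_permSupportedOn.1 h.2 x hx]

theorem permSupportedOn_le_pointwiseFixer {S T : Finset Ψ} (h : Disjoint S T) :
    permSupportedOn S ≤ pointwiseFixer T := fun _ hg =>
  mem_pointwiseFixer.2 fun _ ht =>
    mem_permSupportedOn.1 hg _ fun hs => Finset.disjoint_left.1 h hs ht

theorem conj_mem_pointwiseFixer [DecidableEq Ψ] {S T : Finset Ψ} (h : Disjoint S T)
    {σ n : Equiv.Perm Ψ} (hσ : σ ∈ permSupportedOn S) (hn : n ∈ pointwiseFixer (T ∪ S)) :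
    σ⁻¹ * n * σ ∈ pointwiseFixer (T ∪ S) := by
  refine mem_pointwiseFixer.2 fun t ht => ?_
  have hst : σ t ∈ T ∪ S := by
    rcases Finset.mem_union.1 ht with h1 | h1
    · rw [mem_pointwiseFixer.1 (permSupportedOn_le_pointwiseFixer h hσ) t h1]
      exact ht
    · exact Finset.mem_union_right _ (apply_mem_of_mem_permSupportedOn hσ h1)
  rw [Equiv.Perm.mul_apply, Equiv.Perm.mul_apply, mem_pointwiseFixer.1 hn _ hst,
    Equiv.Perm.inv_eq_iff_eq]

/-- Take for σ the restriction of g to S, extended by the identity. This reduces stability under a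
setwise stabilizer to a finite group and a pointwise stabilizer. -/
theorem exists_eq_mul_of_map_eq [DecidableEq Ψ] {S T : Finset Ψ}
    {g : Equiv.Perm Ψ} (hg : g ∈ pointwiseFixer T) (hS : S.map g.toEmbedding = S) :
    ∃ σ ∈ permSupportedOn S, ∃ n ∈ pointwiseFixer (T ∪ S), g = σ * n := by
  have hmem : ∀ x, g x ∈ S ↔ x ∈ S := fun x => by
    conv_lhs => rw [← hS]
    simp
  let σ : Equiv.Perm Ψ := Equiv.Perm.ofSubtype (g.subtypePerm hmem)
  have hσ : σ ∈ permSupportedOn S := mem_permSupportedOn.2 fun x hx =>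
    Equiv.Perm.ofSubtype_apply_of_not_mem _ hx
  refine ⟨σ, hσ, σ⁻¹ * g, mem_pointwiseFixer.2 fun x hx => ?_, by group⟩
  rw [Equiv.Perm.mul_apply, Equiv.Perm.inv_eq_iff_eq]
  by_cases hxS : x ∈ S
  · exact (Equiv.Perm.ofSubtype_apply_of_mem (g.subtypePerm hmem) hxS).symm
  · have hxT : x ∈ T := (Finset.mem_union.1 hx).resolve_right hxS
    rw [mem_pointwiseFixer.1 hg x hxT, mem_permSupportedOn.1 hσ x hxS]

/-- A bijection S ≃ S' together with the identity of T is a partial injection with finite domain,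
hence extends to a permutation. This transitivity lets a single S₀ represent all sets of its size.
-/
theorem exists_mem_pointwiseFixer_map_eq [DecidableEq Ψ] {S S' T : Finset Ψ}
    (hS : Disjoint S T) (hS' : Disjoint S' T) (hcard : S.card = S'.card) :
    ∃ g ∈ pointwiseFixer T, S.map g.toEmbedding = S' := by
  let e : S ≃ S' := Finset.equivOfCardEq hcard
  let a : T ⊕ S → Ψ := Sum.elim Subtype.val Subtype.val
  let b : T ⊕ S → Ψ := Sum.elim Subtype.val fun x => (e x : Ψ)
  have ha : Function.Injective a := Function.Injective.sumElim Subtype.val_injective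
    Subtype.val_injective fun t s hts => Finset.disjoint_left.1 hS s.2 (hts ▸ t.2)
  have hb : Function.Injective b := Function.Injective.sumElim Subtype.val_injective
    (Subtype.val_injective.comp e.injective)
    fun t s hts => Finset.disjoint_left.1 hS' (e s).2 (hts ▸ t.2)
  obtain ⟨g, hg⟩ := Equiv.Perm.exists_extending_pair a b ha hb
  refine ⟨g, mem_pointwiseFixer.2 fun t ht => hg (Sum.inl ⟨t, ht⟩), ?_⟩
  refine Finset.eq_of_subset_of_card_le (fun y hy => ?_) (by simp [hcard])
  obtain ⟨x, hx, rfl⟩ := Finset.mem_map.1 hy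
  have := hg (Sum.inr ⟨x, hx⟩)
  change g x ∈ S'
  rw [show g x = (e ⟨x, hx⟩ : Ψ) from this]
  exact (e ⟨x, hx⟩).2

theorem map_sdiff_perm [DecidableEq Ψ] {T : Finset Ψ} {g : Equiv.Perm Ψ}
    (hg : g ∈ pointwiseFixer T) (A : Finset Ψ) :
    A.map g.toEmbedding \ T = (A \ T).map g.toEmbedding := by
  have : T.map g.toEmbedding = T := by
    refine Finset.eq_of_subset_of_card_le (fun y hy => ?_) (by simp)
    obtain ⟨x, hx, rfl⟩ := Finset.mem_map.1 hy
    change g x ∈ T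
    rwa [mem_pointwiseFixer.1 hg x hx]
  rw [Finset.map_sdiff, this]

theorem isOpen_pointwiseFixer {Ψ : Type u} (T : Finset Ψ) :
    IsOpen (pointwiseFixer T : Set (Equiv.Perm Ψ)) := by
  have : (pointwiseFixer T : Set (Equiv.Perm Ψ)) =
      ⋂ t ∈ T, (MulAction.stabilizer (Equiv.Perm Ψ) t : Set (Equiv.Perm Ψ)) := by
    ext g
    simp [mem_pointwiseFixer]
  rw [this]
  refine isOpen_biInter_finset fun t _ => TopologicalSpace.isOpen_generateFrom_of_mem
    ⟨1, t, by simp⟩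

theorem exists_pointwiseFixer_coset_subset {Ψ : Type u} {O : Set (Equiv.Perm Ψ)} (hO : IsOpen O)
    {g : Equiv.Perm Ψ} (hg : g ∈ O) : ∃ T : Finset Ψ, ∀ h ∈ pointwiseFixer T, g * h ∈ O := by
  classical
  induction hO with
  | basic S hS =>
    obtain ⟨σ, x, rfl⟩ := hS
    obtain ⟨τ, hτ, rfl⟩ := hg
    refine ⟨{x}, fun h hh => ⟨τ * h, mul_mem hτ ?_, by simp [mul_assoc]⟩⟩
    exact mem_pointwiseFixer.1 hh x (by simp)
  | univ => exact ⟨∅, fun _ _ => trivial⟩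
  | inter U V _ _ hU hV =>
    obtain ⟨A, hA⟩ := hU hg.1
    obtain ⟨B, hB⟩ := hV hg.2
    exact ⟨A ∪ B, fun h hh => ⟨hA h (pointwiseFixer_anti Finset.subset_union_left hh),
      hB h (pointwiseFixer_anti Finset.subset_union_right hh)⟩⟩
  | sUnion 𝒰 _ ih =>
    obtain ⟨U, hU, hgU⟩ := hg
    obtain ⟨A, hA⟩ := ih U hU hgU
    exact ⟨A, fun h hh => ⟨U, hU, hA h hh⟩⟩

end PermutationGroup

/-! ### Semilinear algebra: traces and averaged complements. -/

section Semilinear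

variable {K G M : Type*} [Field K] [Group G] [MulSemiringAction G K]
  [AddCommGroup M] [Module K M] [DistribMulAction G M] [SMulDistribClass G K M]

theorem smul_mem_span_of_forall {s : Set M} {W : Submodule K M} {g : G}
    (h : ∀ x ∈ s, g • x ∈ W) {x : M} (hx : x ∈ Submodule.span K s) : g • x ∈ W := by
  induction hx using Submodule.span_induction with
  | mem x hx => exact h x hx
  | zero => simp
  | add x y _ _ hx hy => rw [smul_add]; exact W.add_mem hx hy
  | smul a x _ hx => rw [smul_distrib_smul]; exact W.smul_mem _ hx

/-- For a finite group of field automorphisms some element has trace `1`. -/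
theorem exists_sum_smul_eq_one [FaithfulSMul G K] (F : Subgroup G) [Fintype F] :
    ∃ c : K, ∑ σ : F, (σ : G) • c = 1 := by
  -- Dedekind's independence of characters: the trace, a combination with all coefficients 1, is not
  -- the zero map.
  have hli : LinearIndependent K
      (fun σ : F => ((MulSemiringAction.toRingHom G K σ : K →* K) : K → K)) := by
    refine (linearIndependent_monoidHom K K).comp
      (fun σ : F => (MulSemiringAction.toRingHom G K σ : K →* K)) fun σ τ h => Subtype.ext ?_
    exact FaithfulSMul.eq_of_smul_eq_smul (α := K) fun a => DFunLike.congr_fun h a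
  have hne : ∃ a : K, ∑ σ : F, (σ : G) • a ≠ 0 := by
    by_contra! h
    have := Fintype.linearIndependent_iff.1 hli (fun _ => 1) (by
      ext a
      simpa using h a) 1
    exact one_ne_zero this
  obtain ⟨a, ha⟩ := hne
  set t := ∑ σ : F, (σ : G) • a with ht
  have hinv : ∀ τ : F, (τ : G) • t = t := fun τ => by
    rw [ht, Finset.smul_sum]
    exact Fintype.sum_equiv (Equiv.mulLeft τ) _ _ fun σ => by simp [mul_smul]
  refine ⟨a * t⁻¹, ?_⟩
  simp_rw [smul_mul', smul_inv'', hinv]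
  rw [← Finset.sum_mul, ← ht, mul_inv_cancel₀ ha]

/-- A subspace spanned by a subset of a spanning set which complements a given subspace. -/
theorem exists_subset_span_isCompl (s : Set M) {Y : Submodule K M} (hY : Y ≤ Submodule.span K s) :
    ∃ t ⊆ s, Submodule.span K t ⊓ Y = ⊥ ∧ Submodule.span K t ⊔ Y = Submodule.span K s := by
  obtain ⟨t, hts, -, hspan, hli⟩ := exists_linearIndepOn_extension (K := K) (v := Y.mkQ)
    (linearIndepOn_empty K _) (Set.empty_subset s)
  refine ⟨t, hts, ?_, le_antisymm (sup_le (Submodule.span_mono hts) hY) ?_⟩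
  · have := Submodule.range_ker_disjoint (f := Y.mkQ) (v := ((↑) : t → M)) hli
    rw [Subtype.range_coe, Submodule.ker_mkQ] at this
    exact this.eq_bot
  · refine Submodule.span_le.2 fun x hx => ?_
    have h1 : Y.mkQ x ∈ (Submodule.span K t).map Y.mkQ := by
      rw [Submodule.map_span]
      exact hspan ⟨x, hx, rfl⟩
    have h2 : x ∈ ((Submodule.span K t).map Y.mkQ).comap Y.mkQ := h1
    rw [Submodule.comap_map_mkQ, sup_comm] at h2
    exact h2

/-- Averaging over a finite group `F` of field automorphisms makes a complement stable. -/
theorem exists_stable_complement (N F : Subgroup G) [Fintype F]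
    (hconj : ∀ σ ∈ F, ∀ n ∈ N, σ⁻¹ * n * σ ∈ N) {c : K} (hcN : ∀ n ∈ N, n • c = c)
    (hc : ∑ σ : F, (σ : G) • c = 1) {X Y C₀ : Submodule K M}
    (hXN : ∀ n ∈ N, ∀ x ∈ X, n • x ∈ X) (hXF : ∀ σ ∈ F, ∀ x ∈ X, σ • x ∈ X)
    (hYN : ∀ n ∈ N, ∀ x ∈ Y, n • x ∈ Y) (hYF : ∀ σ ∈ F, ∀ x ∈ Y, σ • x ∈ Y)
    (hCN : ∀ n ∈ N, ∀ x ∈ C₀, n • x ∈ C₀) (hinf : C₀ ⊓ Y = ⊥) (hsup : C₀ ⊔ Y = X) :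
    ∃ C ≤ X, (∀ n ∈ N, ∀ x ∈ C, n • x ∈ C) ∧ (∀ σ ∈ F, ∀ x ∈ C, σ • x ∈ C) ∧
      C ⊓ Y = ⊥ ∧ C ⊔ Y = X := by
  have hYX : Y ≤ X := hsup ▸ le_sup_right
  -- The auxiliary complement Z of X is arbitrary and need not be stable, so p commutes with N only
  -- on X.
  obtain ⟨p, hpY, hpC⟩ : ∃ p : M →ₗ[K] M, (∀ y ∈ Y, p y = y) ∧ ∀ x ∈ C₀, p x = 0 := by
    obtain ⟨Z, hZ⟩ := Submodule.exists_isCompl X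
    have hcompl : IsCompl Y (C₀ ⊔ Z) := by
      rw [isCompl_iff, disjoint_iff, codisjoint_iff]
      constructor
      · rw [eq_bot_iff]
        rintro y ⟨hy, hyCZ⟩
        obtain ⟨u, hu, z, hz, rfl⟩ := Submodule.mem_sup.1 hyCZ
        have hz0 : z = 0 := by
          have hzX : z ∈ X := by
            have := X.sub_mem (hYX hy) ((hsup ▸ le_sup_left : C₀ ≤ X) hu)
            simpa using this
          exact (Submodule.disjoint_def.1 hZ.disjoint) z hzX hz
        subst hz0
        have : u + 0 ∈ C₀ ⊓ Y := ⟨by simpa using hu, hy⟩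
        rwa [hinf] at this
      · rw [← sup_assoc, sup_comm Y, hsup, hZ.sup_eq_top]
    refine ⟨Y.subtype ∘ₗ Y.projectionOnto _ hcompl, fun y hy => ?_, fun x hx => ?_⟩
    · exact congrArg Subtype.val (Submodule.projectionOnto_apply_left hcompl ⟨y, hy⟩)
    · have : x ∈ C₀ ⊔ Z := Submodule.mem_sup_left hx
      exact congrArg Subtype.val ((Submodule.projectionOnto_apply_eq_zero_iff hcompl).2 this)
  have hpX : ∀ x ∈ X, p x ∈ Y := fun x hx => by
    rw [← hsup] at hx
    obtain ⟨u, hu, y, hy, rfl⟩ := Submodule.mem_sup.1 hx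
    rw [map_add, hpC u hu, hpY y hy, zero_add]
    exact hy
  have hpN : ∀ n ∈ N, ∀ x ∈ X, p (n • x) = n • p x := fun n hn x hx => by
    rw [← hsup] at hx
    obtain ⟨u, hu, y, hy, rfl⟩ := Submodule.mem_sup.1 hx
    rw [smul_add, map_add, map_add, hpC u hu, hpY y hy, hpC _ (hCN n hn u hu),
      hpY _ (hYN n hn y hy), zero_add, zero_add]
  -- Average of the conjugates of p with weights σ(c). The weights sum to 1, so q is still the
  -- identity on Y. Equivariance under N survives since c is fixed by N and F normalizes N.
  let q : M →ₗ[K] M :=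
    { toFun := fun x => ∑ σ : F, ((σ : G) • c) • ((σ : G) • p ((σ : G)⁻¹ • x))
      map_add' := fun x y => by simp [smul_add, Finset.sum_add_distrib]
      map_smul' := fun a x => by
        rw [RingHom.id_apply, Finset.smul_sum]
        refine Finset.sum_congr rfl fun σ _ => ?_
        rw [smul_distrib_smul (σ : G)⁻¹, p.map_smul, smul_distrib_smul (σ : G), smul_inv_smul,
          smul_comm] }
  have hq : ∀ x, q x = ∑ σ : F, ((σ : G) • c) • ((σ : G) • p ((σ : G)⁻¹ • x)) := fun _ => rfl
  have hqY : ∀ y ∈ Y, q y = y := fun y hy => by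
    rw [hq]
    have : ∀ σ : F, ((σ : G) • c) • ((σ : G) • p ((σ : G)⁻¹ • y)) = ((σ : G) • c) • y :=
      fun σ => by rw [hpY _ (hYF _ (inv_mem σ.2) y hy), smul_inv_smul]
    simp_rw [this]
    rw [← Finset.sum_smul, hc, one_smul]
  have hqX : ∀ x ∈ X, q x ∈ Y := fun x hx =>
    Y.sum_mem fun σ _ => Y.smul_mem _ (hYF _ σ.2 _ (hpX _ (hXF _ (inv_mem σ.2) x hx)))
  have hqF : ∀ τ ∈ F, ∀ x, q (τ • x) = τ • q x := fun τ hτ x => by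
    rw [hq, hq, Finset.smul_sum]
    symm
    refine Fintype.sum_equiv (Equiv.mulLeft (⟨τ, hτ⟩ : F)) _ _ fun σ => ?_
    simp [mul_smul, smul_distrib_smul]
  have hqN : ∀ n ∈ N, ∀ x ∈ X, q (n • x) = n • q x := fun n hn x hx => by
    rw [hq, hq, Finset.smul_sum]
    refine Finset.sum_congr rfl fun σ _ => ?_
    have hn' := hconj _ σ.2 n hn
    rw [smul_distrib_smul n]
    congr 1
    · conv_lhs => rw [← hcN _ hn']
      simp [smul_smul, mul_assoc]
    · have : (σ : G)⁻¹ • n • x = ((σ : G)⁻¹ * n * σ) • ((σ : G)⁻¹ • x) := by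
        simp [smul_smul, mul_assoc]
      rw [this, hpN _ hn' _ (hXF _ (inv_mem σ.2) x hx)]
      simp [smul_smul, mul_assoc]
  refine ⟨X ⊓ LinearMap.ker q, inf_le_left, fun n hn x hx => ⟨hXN n hn x hx.1, ?_⟩,
    fun σ hσ x hx => ⟨hXF σ hσ x hx.1, ?_⟩, ?_, le_antisymm (sup_le inf_le_left hYX) ?_⟩
  · rw [SetLike.mem_coe, LinearMap.mem_ker, hqN n hn x hx.1, LinearMap.mem_ker.1 hx.2, smul_zero]
  · rw [SetLike.mem_coe, LinearMap.mem_ker, hqF σ hσ x, LinearMap.mem_ker.1 hx.2, smul_zero]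
  · rw [eq_bot_iff]
    rintro x ⟨⟨-, hx⟩, hxY⟩
    rw [Submodule.mem_bot, ← hqY x hxY]
    exact hx
  · intro x hx
    refine Submodule.mem_sup.2 ⟨x - q x, ⟨X.sub_mem hx (hYX (hqX x hx)), ?_⟩, q x, hqX x hx,
      sub_add_cancel _ _⟩
    rw [SetLike.mem_coe, LinearMap.mem_ker, map_sub, hqY _ (hqX x hx), sub_self]

end Semilinear

/-! ### Filtration of a span by the size of supports. -/

section Spans

variable {Ψ N : Type*} (K : Type*) [DecidableEq Ψ] [Field K] [AddCommGroup N] [Module K N]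

/-- The span of the generators whose support has fewer than `s` elements outside of `T`. -/
def lowerSpan (D : Finset Ψ → Set N) (s : ℕ) (T : Finset Ψ) : Submodule K N :=
  Submodule.span K {v | ∃ A, v ∈ D A ∧ (A \ T).card < s}

/-- The span of the generators whose support is `S` outside of `T`. -/
def supportSpan (D : Finset Ψ → Set N) (T S : Finset Ψ) : Submodule K N :=
  Submodule.span K {v | ∃ A, v ∈ D A ∧ A \ T = S}

variable {K}

theorem lowerSpan_mono (D : Finset Ψ → Set N) (s : ℕ) {T T' : Finset Ψ} (h : T ⊆ T') :
    lowerSpan K D s T ≤ lowerSpan K D s T' :=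
  Submodule.span_mono fun _ ⟨A, hv, hA⟩ =>
    ⟨A, hv, (Finset.card_le_card (Finset.sdiff_subset_sdiff subset_rfl h)).trans_lt hA⟩

end Spans

/-! ### Equivariant lifting by induction on support size. -/

section Splitting

variable {Ψ K M N : Type*} [DecidableEq Ψ] [Field K] [MulSemiringAction (Equiv.Perm Ψ) K]
  [AddCommGroup M] [Module K M] [DistribMulAction (Equiv.Perm Ψ) M]
  [SMulDistribClass (Equiv.Perm Ψ) K M]
  [AddCommGroup N] [Module K N] [DistribMulAction (Equiv.Perm Ψ) N]
  [SMulDistribClass (Equiv.Perm Ψ) K N]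

/-- A family of finite sets of vectors `D A` indexed by finite sets `A`, stable under the pointwise
stabilizer of `T`. -/
structure IsGeneratingFamily (D : Finset Ψ → Set N) (T : Finset Ψ) : Prop where
  finite : ∀ A, (D A).Finite
  smul_mem : ∀ g ∈ pointwiseFixer T, ∀ A, ∀ v ∈ D A, g • v ∈ D (A.map g.toEmbedding)

namespace IsGeneratingFamily

variable {D : Finset Ψ → Set N} {T : Finset Ψ}

theorem smul_mem_lowerSpan (hD : IsGeneratingFamily D T) {g : Equiv.Perm Ψ}
    (hg : g ∈ pointwiseFixer T) (s : ℕ) (T₁ : Finset Ψ) {v : N} (hv : v ∈ lowerSpan K D s T₁) :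
    g • v ∈ lowerSpan K D s (T₁.map g.toEmbedding) := by
  refine smul_mem_span_of_forall ?_ hv
  rintro x ⟨A, hx, hA⟩
  refine Submodule.subset_span ⟨_, hD.smul_mem g hg A x hx, ?_⟩
  rwa [← Finset.map_sdiff, Finset.card_map]

theorem smul_mem_lowerSpan_self (hD : IsGeneratingFamily D T) {T₁ : Finset Ψ} (hT : T ⊆ T₁)
    {g : Equiv.Perm Ψ} (hg : g ∈ pointwiseFixer T₁) {s : ℕ} {v : N}
    (hv : v ∈ lowerSpan K D s T₁) : g • v ∈ lowerSpan K D s T₁ := by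
  refine smul_mem_span_of_forall ?_ hv
  rintro x ⟨A, hx, hA⟩
  refine Submodule.subset_span ⟨_, hD.smul_mem g (pointwiseFixer_anti hT hg) A x hx, ?_⟩
  rwa [map_sdiff_perm hg, Finset.card_map]

theorem smul_mem_supportSpan (hD : IsGeneratingFamily D T) {g : Equiv.Perm Ψ}
    (hg : g ∈ pointwiseFixer T) {S : Finset Ψ} {v : N} (hv : v ∈ supportSpan K D T S) :
    g • v ∈ supportSpan K D T (S.map g.toEmbedding) := by
  refine smul_mem_span_of_forall ?_ hv
  rintro x ⟨A, hx, rfl⟩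
  exact Submodule.subset_span ⟨_, hD.smul_mem g hg A x hx, map_sdiff_perm hg A⟩

/-- Only the finitely many A ⊆ T ∪ S contribute. This yields the finite dimension on which the
stabilization argument rests. -/
theorem finite_setOf_sdiff_eq (hD : IsGeneratingFamily D T) (S : Finset Ψ) :
    {v | ∃ A, v ∈ D A ∧ A \ T = S}.Finite := by
  refine (Set.Finite.biUnion (T ∪ S).powerset.finite_toSet fun A _ => hD.finite A).subset ?_
  rintro v ⟨A, hv, rfl⟩
  refine Set.mem_biUnion (x := A) (Finset.mem_coe.2 (Finset.mem_powerset.2 ?_)) hv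
  rw [Finset.union_sdiff_self_eq_union]
  exact Finset.subset_union_right

/-- The lower spans eventually cut out everything they ever will from the span of the generators
with a given support. -/
theorem exists_inf_lowerSpan_le (hD : IsGeneratingFamily D T) {S₀ : Finset Ψ}
    (hS₀ : Disjoint S₀ T) (s : ℕ) :
    ∃ T₁, T ⊆ T₁ ∧ Disjoint S₀ T₁ ∧ ∀ S, S.card = S₀.card → Disjoint S T₁ → ∀ T₂, Disjoint S T₂ →
      supportSpan K D T S ⊓ lowerSpan K D s T₂ ≤ lowerSpan K D s T₁ := by
  have : Module.Finite K (supportSpan K D T S₀) :=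
    Module.Finite.iff_fg.2 (Submodule.fg_span (hD.finite_setOf_sdiff_eq S₀))
  let f : Finset Ψ → Submodule K (supportSpan K D T S₀) := fun T' =>
    (lowerSpan K D s T').comap (supportSpan K D T S₀).subtype
  -- The traces of the lower spans on a finite-dimensional space grow with T', so a maximal one
  -- absorbs all the others.
  obtain ⟨_, ⟨T₁, ⟨hT₁, hd₁⟩, rfl⟩, hmax⟩ := set_has_maximal_iff_noetherian.2
    (inferInstance : IsNoetherian K (supportSpan K D T S₀)) (f '' {T' | T ⊆ T' ∧ Disjoint S₀ T'})
    ⟨_, T, ⟨subset_rfl, hS₀⟩, rfl⟩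
  have hmain : ∀ T₂, Disjoint S₀ T₂ →
      supportSpan K D T S₀ ⊓ lowerSpan K D s T₂ ≤ lowerSpan K D s T₁ := by
    rintro T₂ hd₂ x ⟨hxW, hxL⟩
    have hle : f T₁ ≤ f (T₁ ∪ T₂) :=
      Submodule.comap_mono (lowerSpan_mono D s Finset.subset_union_left)
    have hnlt := hmax _ ⟨T₁ ∪ T₂, ⟨hT₁.trans Finset.subset_union_left,
      Finset.disjoint_union_right.2 ⟨hd₁, hd₂⟩⟩, rfl⟩
    have hge : f (T₁ ∪ T₂) ≤ f T₁ := by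
      by_contra h
      exact hnlt (lt_of_le_not_ge hle h)
    exact hge (x := ⟨x, hxW⟩) (lowerSpan_mono D s Finset.subset_union_right hxL)
  refine ⟨T₁, hT₁, hd₁, fun S hcard hS T₂ hST₂ x hx => ?_⟩
  -- Move S to S₀ by an element fixing T₁, apply the case of S₀, and move back: the lower span of T₁
  -- is stable.
  obtain ⟨g, hg, hgS⟩ := exists_mem_pointwiseFixer_map_eq hS hd₁ hcard
  have hgT := pointwiseFixer_anti hT₁ hg
  have h1 := hmain (T₂.map g.toEmbedding) (by rw [← hgS]; exact (Finset.disjoint_map _).2 hST₂)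
    ⟨hgS ▸ hD.smul_mem_supportSpan hgT hx.1, hD.smul_mem_lowerSpan hgT s T₂ hx.2⟩
  simpa using hD.smul_mem_lowerSpan_self hT₁ (inv_mem hg) h1

/-- The span of the generators with a given support lifts, modulo the lower span. -/
theorem exists_lift_supportSpan [FaithfulSMul (Equiv.Perm Ψ) K]
    (hK : ∀ a : K, ∃ A : Finset Ψ, ∀ g ∈ pointwiseFixer A, g • a = a)
    (hM : ∀ m : M, ∃ A : Finset Ψ, ∀ g ∈ pointwiseFixer A, g • m = m)
    (π : M →ₗ[K] N) (hπ : ∀ (g : Equiv.Perm Ψ) m, π (g • m) = g • π m)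
    (hD : IsGeneratingFamily D T) (hrange : ∀ A, ∀ v ∈ D A, v ∈ LinearMap.range π)
    {S₀ T₁ : Finset Ψ} (hT : T ⊆ T₁) (hS₀ : Disjoint S₀ T₁) (s : ℕ) :
    ∃ T₂, T₁ ⊆ T₂ ∧ Disjoint S₀ T₂ ∧ ∃ C : Submodule K M,
      (∀ g ∈ pointwiseFixer T₂, S₀.map g.toEmbedding = S₀ → ∀ x ∈ C, g • x ∈ C) ∧
      C.map π ≤ supportSpan K D T S₀ ∧ C ⊓ (lowerSpan K D s T₂).comap π = ⊥ ∧
      supportSpan K D T S₀ ≤ C.map π ⊔ lowerSpan K D s T₂ := by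
  let E : Set N := {v | ∃ A, v ∈ D A ∧ A \ T = S₀}
  have hE : E.Finite := hD.finite_setOf_sdiff_eq S₀
  obtain ⟨r, hr⟩ : ∃ r : N → M, ∀ v ∈ E, π (r v) = v := by
    have : ∀ v : N, ∃ m : M, v ∈ E → π m = v := fun v => by
      by_cases hv : v ∈ E
      · obtain ⟨A, hA, -⟩ := hv
        obtain ⟨m, hm⟩ := hrange A v hA
        exact ⟨m, fun _ => hm⟩
      · exact ⟨0, fun h => absurd h hv⟩
    choose r hr using this
    exact ⟨r, fun v => hr v⟩
  have := Fintype.ofFinite (permSupportedOn S₀)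
  obtain ⟨c, hc⟩ := exists_sum_smul_eq_one (K := K) (permSupportedOn S₀)
  obtain ⟨A₀, hA₀⟩ := hK c
  choose supp hsupp using hM
  let B : Finset Ψ := A₀ ∪ hE.toFinset.biUnion fun v => supp (r v)
  -- Removing S₀ keeps T₂ disjoint from it, yet T₂ ∪ S₀ still contains supports of c and of all
  -- chosen lifts.
  let T₂ : Finset Ψ := T₁ ∪ B \ S₀
  have hT₂ : T₁ ⊆ T₂ := Finset.subset_union_left
  have hd₂ : Disjoint S₀ T₂ := Finset.disjoint_union_right.2 ⟨hS₀, Finset.disjoint_sdiff⟩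
  have hB : B ⊆ T₂ ∪ S₀ := fun x hx => by
    by_cases h : x ∈ S₀
    · exact Finset.mem_union_right _ h
    · exact Finset.mem_union_left _ (Finset.mem_union_right _ (Finset.mem_sdiff.2 ⟨hx, h⟩))
  have hcN : ∀ n ∈ pointwiseFixer (T₂ ∪ S₀), n • c = c := fun n hn =>
    hA₀ n (pointwiseFixer_anti (Finset.subset_union_left.trans hB) hn)
  have hrN : ∀ v ∈ E, ∀ n ∈ pointwiseFixer (T₂ ∪ S₀), n • r v = r v := fun v hv n hn =>
    hsupp _ n (pointwiseFixer_anti ((Finset.subset_biUnion_of_mem (fun v => supp (r v))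
      (hE.mem_toFinset.2 hv)).trans (Finset.subset_union_right.trans hB)) hn)
  have hTS : permSupportedOn S₀ ≤ pointwiseFixer T₂ := permSupportedOn_le_pointwiseFixer hd₂
  have hNT : pointwiseFixer (T₂ ∪ S₀) ≤ pointwiseFixer T₂ :=
    pointwiseFixer_anti Finset.subset_union_left
  -- All vectors of R are fixed by the stabilizer of T₂ ∪ S₀, so every subset of R spans a stable
  -- subspace. A complement spanned by part of R therefore needs averaging only over Sym(S₀).
  let R : Set M := {m | ∃ σ ∈ permSupportedOn S₀, ∃ v ∈ E, m = σ • r v}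
  have hRN : ∀ m ∈ R, ∀ n ∈ pointwiseFixer (T₂ ∪ S₀), n • m = m := by
    rintro _ ⟨σ, hσ, v, hv, rfl⟩ n hn
    have := hrN v hv _ (conj_mem_pointwiseFixer hd₂ hσ hn)
    rwa [mul_assoc, mul_smul, inv_smul_eq_iff, mul_smul] at this
  have hspanN : ∀ R' ⊆ R, ∀ n ∈ pointwiseFixer (T₂ ∪ S₀), ∀ x ∈ Submodule.span K R',
      n • x ∈ Submodule.span K R' := fun R' hR' n hn x hx =>
    smul_mem_span_of_forall (fun y hy => by
      rw [hRN y (hR' hy) n hn]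
      exact Submodule.subset_span hy) hx
  have hspanF : ∀ σ ∈ permSupportedOn S₀, ∀ x ∈ Submodule.span K R,
      σ • x ∈ Submodule.span K R := fun σ hσ x hx => by
    refine smul_mem_span_of_forall ?_ hx
    rintro _ ⟨τ, hτ, v, hv, rfl⟩
    exact Submodule.subset_span ⟨σ * τ, mul_mem hσ hτ, v, hv, smul_smul _ _ _⟩
  have hmapS₀ : ∀ σ ∈ permSupportedOn S₀, S₀.map σ.toEmbedding = S₀ := fun σ hσ => by
    refine Finset.eq_of_subset_of_card_le (fun y hy => ?_) (by simp)
    obtain ⟨x, hx, rfl⟩ := Finset.mem_map.1 hy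
    exact apply_mem_of_mem_permSupportedOn hσ hx
  have hXW : (Submodule.span K R).map π ≤ supportSpan K D T S₀ := by
    rw [Submodule.map_span, Submodule.span_le]
    rintro _ ⟨_, ⟨σ, hσ, v, hv, rfl⟩, rfl⟩
    rw [hπ, hr v hv, SetLike.mem_coe]
    conv => rw [← hmapS₀ σ hσ]
    exact hD.smul_mem_supportSpan (pointwiseFixer_anti (hT.trans hT₂) (hTS hσ))
      (Submodule.subset_span hv)
  have hWX : supportSpan K D T S₀ ≤ (Submodule.span K R).map π := Submodule.span_le.2 fun v hv =>
    ⟨r v, Submodule.subset_span ⟨1, one_mem _, v, hv, (one_smul _ _).symm⟩, hr v hv⟩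
  set L := (lowerSpan K D s T₂).comap π with hL
  have hLG : ∀ g ∈ pointwiseFixer T₂, ∀ x ∈ L, g • x ∈ L := fun g hg x hx => by
    rw [hL, Submodule.mem_comap, hπ]
    exact hD.smul_mem_lowerSpan_self (hT.trans hT₂) hg hx
  obtain ⟨R', hR', hinf, hsup⟩ := exists_subset_span_isCompl R
    (inf_le_left : Submodule.span K R ⊓ L ≤ Submodule.span K R)
  obtain ⟨C, hCX, hCN, hCF, hCinf, hCsup⟩ := exists_stable_complement
    (pointwiseFixer (T₂ ∪ S₀)) (permSupportedOn S₀)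
    (fun σ hσ n hn => conj_mem_pointwiseFixer hd₂ hσ hn) hcN hc
    (hspanN R subset_rfl) hspanF
    (fun n hn x hx => Submodule.mem_inf.2
      ⟨hspanN R subset_rfl n hn x hx.1, hLG n (hNT hn) x hx.2⟩)
    (fun σ hσ x hx => Submodule.mem_inf.2 ⟨hspanF σ hσ x hx.1, hLG σ (hTS hσ) x hx.2⟩)
    (hspanN R' hR') hinf hsup
  refine ⟨T₂, hT₂, hd₂, C, fun g hg hgS x hx => ?_, (Submodule.map_mono hCX).trans hXW, ?_, ?_⟩
  · obtain ⟨σ, hσ, n, hn, rfl⟩ := exists_eq_mul_of_map_eq hg hgS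
    rw [mul_smul]
    exact hCF σ hσ _ (hCN n hn x hx)
  · rw [← hCinf, ← inf_assoc, inf_eq_left.2 hCX]
  · refine hWX.trans ?_
    rw [← hCsup, Submodule.map_sup]
    exact sup_le_sup_left ((Submodule.map_mono inf_le_right).trans (Submodule.map_comap_le _ _)) _

end IsGeneratingFamily

/-- A linear surjection onto the span of a generating family splits over an open subgroup. -/
theorem exists_stable_lift [Infinite Ψ] [FaithfulSMul (Equiv.Perm Ψ) K]
    (hK : ∀ a : K, ∃ A : Finset Ψ, ∀ g ∈ pointwiseFixer A, g • a = a)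
    (hM : ∀ m : M, ∃ A : Finset Ψ, ∀ g ∈ pointwiseFixer A, g • m = m)
    (π : M →ₗ[K] N) (hπ : ∀ (g : Equiv.Perm Ψ) m, π (g • m) = g • π m) (s : ℕ)
    (D : Finset Ψ → Set N) (T : Finset Ψ) (hD : IsGeneratingFamily D T)
    (hrange : ∀ A, ∀ v ∈ D A, v ∈ LinearMap.range π)
    (hs : ∀ A, ∀ v ∈ D A, (A \ T).card < s) :
    ∃ T', ∃ C : Submodule K M, T ⊆ T' ∧ (∀ g ∈ pointwiseFixer T', ∀ x ∈ C, g • x ∈ C) ∧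
      C ⊓ LinearMap.ker π = ⊥ ∧ C.map π = Submodule.span K {v | ∃ A, v ∈ D A} := by
  induction s generalizing D T with
  | zero =>
    refine ⟨T, ⊥, subset_rfl, by simp, by simp, ?_⟩
    rw [Submodule.map_bot, eq_comm, Submodule.span_eq_bot]
    rintro v ⟨A, hv⟩
    exact absurd (hs A v hv) (Nat.not_lt_zero _)
  | succ s ih =>
    -- Infinitude of Ψ supplies a model support of size s outside T.
    obtain ⟨S₀, hS₀T, hS₀⟩ : ∃ S₀ : Finset Ψ, Disjoint S₀ T ∧ S₀.card = s := by
      obtain ⟨S₀, hsub, hcard⟩ := (T.finite_toSet.infinite_compl).exists_subset_card_eq s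
      exact ⟨S₀, Finset.disjoint_left.2 fun x hx => hsub hx, hcard⟩
    obtain ⟨T₁, hT₁, hd₁, hstab⟩ := hD.exists_inf_lowerSpan_le (K := K) hS₀T s
    obtain ⟨T₂, hT₂, hd₂, C₀, hC₀G, hC₀W, hC₀L, hWC₀⟩ :=
      hD.exists_lift_supportSpan hK hM π hπ hrange hT₁ hd₁ s
    have hTT₂ : T ⊆ T₂ := hT₁.trans hT₂
    obtain ⟨T₃, C', hT₃, hC'G, hC'inf, hC'map⟩ := ih (fun A => {v | v ∈ D A ∧ (A \ T₂).card < s}) T₂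
      { finite := fun A => (hD.finite A).subset fun v hv => hv.1
        smul_mem := fun g hg A v hv => ⟨hD.smul_mem g (pointwiseFixer_anti hTT₂ hg) A v hv.1, by
          rw [map_sdiff_perm hg, Finset.card_map]
          exact hv.2⟩ }
      (fun A v hv => hrange A v hv.1) fun A v hv => hv.2
    change C'.map π = lowerSpan K D s T₂ at hC'map
    -- The translate of C₀ to S; it is independent of the translating g since C₀ is stable under the
    -- setwise stabilizer of S₀. It is zero when S is not in the orbit.
    let C : Finset Ψ → Submodule K M := fun S => Submodule.span K
      {m | ∃ g ∈ pointwiseFixer T₂, S₀.map g.toEmbedding = S ∧ ∃ x ∈ C₀, g • x = m}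
    have hCinv : ∀ S, ∀ g ∈ pointwiseFixer T₂, S₀.map g.toEmbedding = S → ∀ x ∈ C S,
        g⁻¹ • x ∈ C₀ := by
      rintro S g hg rfl x hx
      refine smul_mem_span_of_forall ?_ hx
      rintro _ ⟨h, hh, hhS, y, hy, rfl⟩
      rw [smul_smul]
      refine hC₀G _ (mul_mem (inv_mem hg) hh) ?_ y hy
      have : (g⁻¹ * h).toEmbedding = h.toEmbedding.trans (g⁻¹).toEmbedding := rfl
      rw [this, ← Finset.map_map, hhS, Finset.map_map]
      convert Finset.map_refl
      ext x
      simp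
    have hCW : ∀ S, (C S).map π ≤ supportSpan K D T S := fun S => by
      rw [Submodule.map_span, Submodule.span_le]
      rintro _ ⟨_, ⟨g, hg, rfl, x, hx, rfl⟩, rfl⟩
      rw [hπ]
      exact hD.smul_mem_supportSpan (pointwiseFixer_anti hTT₂ hg) (hC₀W ⟨x, hx, rfl⟩)
    have hCzero : ∀ S, (¬ ∃ g ∈ pointwiseFixer T₂, S₀.map g.toEmbedding = S) → C S = ⊥ := by
      intro S hS
      rw [Submodule.span_eq_bot]
      rintro _ ⟨g, hg, hgS, -⟩
      exact absurd ⟨g, hg, hgS⟩ hS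
    have hcardS : ∀ S, (∃ g ∈ pointwiseFixer T₂, S₀.map g.toEmbedding = S) →
        S.card = s ∧ Disjoint S T₂ := by
      rintro _ ⟨g, hg, rfl⟩
      refine ⟨by rw [Finset.card_map, hS₀], Finset.disjoint_left.2 fun x hx hxT => ?_⟩
      obtain ⟨y, hy, rfl⟩ := Finset.mem_map.1 hx
      have : g (g y) = g y := mem_pointwiseFixer.1 hg _ hxT
      rw [Equiv.coe_toEmbedding, g.injective this] at hxT
      exact Finset.disjoint_left.1 hd₂ hy hxT
    have hCind : ∀ S, ∀ x ∈ C S, ∀ T₄, Disjoint S T₄ → π x ∈ lowerSpan K D s T₄ → x = 0 := by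
      intro S x hx T₄ hST₄ hπx
      by_cases hS : ∃ g ∈ pointwiseFixer T₂, S₀.map g.toEmbedding = S
      · obtain ⟨hcard, hdis⟩ := hcardS S hS
        obtain ⟨g, hg, hgS⟩ := hS
        have h1 : π x ∈ lowerSpan K D s T₂ := lowerSpan_mono D s hT₂
          (hstab S (hcard.trans hS₀.symm) (hdis.mono_right hT₂) T₄ hST₄
            ⟨hCW S ⟨x, hx, rfl⟩, hπx⟩)
        have h2 : g⁻¹ • x ∈ C₀ ⊓ (lowerSpan K D s T₂).comap π := by
          refine ⟨hCinv S g hg hgS x hx, ?_⟩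
          rw [SetLike.mem_coe, Submodule.mem_comap, hπ]
          exact hD.smul_mem_lowerSpan_self hTT₂ (inv_mem hg) h1
        rw [hC₀L, Submodule.mem_bot] at h2
        exact (smul_eq_zero_iff_eq _).1 h2
      · rw [hCzero S hS, Submodule.mem_bot] at hx
        exact hx
    refine ⟨T₃, C' ⊔ ⨆ S, C S, hTT₂.trans hT₃, fun g hg x hx => ?_, ?_, ?_⟩
    · obtain ⟨x₁, hx₁, x₂, hx₂, rfl⟩ := Submodule.mem_sup.1 hx
      rw [smul_add]
      refine add_mem (Submodule.mem_sup_left (hC'G g hg x₁ hx₁)) (Submodule.mem_sup_right ?_)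
      rw [← Submodule.span_iUnion] at hx₂
      refine smul_mem_span_of_forall (fun y hy => ?_) hx₂
      obtain ⟨S, h, hh, hS, z, hz, rfl⟩ := Set.mem_iUnion.1 hy
      rw [smul_smul]
      exact Submodule.mem_iSup_of_mem (S₀.map (g * h).toEmbedding) (Submodule.subset_span
        ⟨g * h, mul_mem (pointwiseFixer_anti hT₃ hg) hh, rfl, z, hz, rfl⟩)
    · rw [eq_bot_iff]
      rintro x ⟨hx, hπx⟩
      obtain ⟨x₁, hx₁, x₂, hx₂, rfl⟩ := Submodule.mem_sup.1 hx
      obtain ⟨f, hf, rfl⟩ := (Submodule.mem_iSup_iff_exists_finsupp _ _).1 hx₂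
      have hker : π x₁ + ∑ S ∈ f.support, π (f S) = 0 := by
        simpa [Finsupp.sum] using hπx
      have hx₁L : ∀ T₄, T₂ ⊆ T₄ → π x₁ ∈ lowerSpan K D s T₄ := fun T₄ h =>
        lowerSpan_mono D s h (hC'map ▸ ⟨x₁, hx₁, rfl⟩)
      have hf0 : ∀ S, f S = 0 := by
        intro S
        by_cases hSf : S ∈ f.support
        swap
        · simpa using hSf
        have hSg : ∃ g ∈ pointwiseFixer T₂, S₀.map g.toEmbedding = S := by
          by_contra h
          have h1 := hf S
          rw [hCzero S h, Submodule.mem_bot] at h1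
          exact Finsupp.mem_support_iff.1 hSf h1
        obtain ⟨hcard, hdis⟩ := hcardS S hSg
        -- Relative to T₄, any other S' in the relation retains only S' ∩ S. This has fewer than s
        -- elements, as S and S' are distinct of size s.
        let T₄ := T₂ ∪ (f.support.biUnion id) \ S
        refine hCind S _ (hf S) T₄
          (Finset.disjoint_union_right.2 ⟨hdis, Finset.disjoint_sdiff⟩) ?_
        have hS : π (f S) = -(π x₁ + ∑ S' ∈ f.support.erase S, π (f S')) := by
          rw [← Finset.add_sum_erase _ _ hSf] at hker
          rw [eq_neg_iff_add_eq_zero, ← hker]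
          abel
        rw [hS]
        refine neg_mem (add_mem (hx₁L T₄ Finset.subset_union_left) (sum_mem fun S' hS' => ?_))
        obtain ⟨hne, hS'f⟩ := Finset.mem_erase.1 hS'
        have hS'g : ∃ g ∈ pointwiseFixer T₂, S₀.map g.toEmbedding = S' := by
          by_contra h
          have h1 := hf S'
          rw [hCzero S' h, Submodule.mem_bot] at h1
          exact Finsupp.mem_support_iff.1 hS'f h1
        have hcard' := (hcardS S' hS'g).1
        have hWL : supportSpan K D T S' ≤ lowerSpan K D s T₄ := by
          refine Submodule.span_mono ?_
          rintro v ⟨A, hv, hA⟩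
          refine ⟨A, hv, ?_⟩
          have hsub : A \ T₄ ⊆ S' ∩ S := fun y hy => by
            obtain ⟨hyA, hyT⟩ := Finset.mem_sdiff.1 hy
            have hyS' : y ∈ S' := by
              rw [← hA]
              exact Finset.mem_sdiff.2
                ⟨hyA, fun h => hyT (Finset.mem_union_left _ (hTT₂ h))⟩
            refine Finset.mem_inter.2 ⟨hyS', by_contra fun hyS => hyT ?_⟩
            exact Finset.mem_union_right _ (Finset.mem_sdiff.2
              ⟨Finset.mem_biUnion.2 ⟨S', hS'f, hyS'⟩, hyS⟩)
          refine (Finset.card_le_card hsub).trans_lt (hcard' ▸ Finset.card_lt_card ?_)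
          refine Finset.inter_subset_left.ssubset_of_ne fun h => hne ?_
          exact Finset.eq_of_subset_of_card_le (Finset.inter_eq_left.1 h) (by rw [hcard, hcard'])
        exact hWL (hCW S' ⟨_, hf S', rfl⟩)
      have hsum : (f.sum fun _ x => x) = 0 := Finset.sum_eq_zero fun S _ => hf0 S
      rw [hsum, add_zero] at hπx ⊢
      rw [← hC'inf]
      exact ⟨hx₁, hπx⟩
    · refine le_antisymm ?_ (Submodule.span_le.2 ?_)
      · rw [Submodule.map_sup, Submodule.map_iSup, hC'map]
        refine sup_le (Submodule.span_mono fun v ⟨A, hv, _⟩ => ⟨A, hv⟩) (iSup_le fun S => ?_)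
        exact (hCW S).trans (Submodule.span_mono fun v ⟨A, hv, _⟩ => ⟨A, hv⟩)
      · rintro v ⟨A, hv⟩
        rw [SetLike.mem_coe, Submodule.map_sup, hC'map]
        by_cases hA : (A \ T₂).card < s
        · exact Submodule.mem_sup_left (Submodule.subset_span ⟨A, hv, hA⟩)
        have hsub : A \ T₂ ⊆ A \ T := Finset.sdiff_subset_sdiff subset_rfl hTT₂
        -- A generator not covered by the induction has exactly s support points outside T, none of
        -- them in T₂, so its support can be carried to S₀ by an element fixing T₂.
        have heq : A \ T₂ = A \ T := Finset.eq_of_subset_of_card_le hsub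
          ((Nat.lt_succ_iff.1 (hs A v hv)).trans (not_lt.1 hA))
        have hcard : (A \ T).card = s :=
          le_antisymm (Nat.lt_succ_iff.1 (hs A v hv)) (heq ▸ not_lt.1 hA)
        obtain ⟨g, hg, hgS⟩ := exists_mem_pointwiseFixer_map_eq hd₂
          (heq ▸ Finset.sdiff_disjoint : Disjoint (A \ T) T₂) (hS₀.trans hcard.symm)
        have hv1 : g⁻¹ • v ∈ supportSpan K D T S₀ := by
          have := hD.smul_mem_supportSpan (K := K) (pointwiseFixer_anti hTT₂ (inv_mem hg))
            (Submodule.subset_span ⟨A, hv, rfl⟩ : v ∈ supportSpan K D T (A \ T))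
          rw [← hgS, Finset.map_map] at this
          convert this
          rw [eq_comm]
          convert Finset.map_refl
          ext x
          simp
        obtain ⟨_, ⟨x, hx, rfl⟩, y, hy, hxy⟩ := Submodule.mem_sup.1 (hWC₀ hv1)
        have hvxy : v = g • y + π (g • x) := by
          rw [hπ, ← smul_add, add_comm, hxy, smul_inv_smul]
        rw [hvxy]
        refine Submodule.add_mem_sup (hD.smul_mem_lowerSpan_self hTT₂ hg hy) ?_
        exact Submodule.mem_map_of_mem (Submodule.mem_iSup_of_mem (A \ T)
          (Submodule.subset_span ⟨g, hg, hgS, x, hx, rfl⟩))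

end Splitting

/-! ### From modules over the skew group ring to semilinear actions. -/

section SkewModules

variable {K : Type u} [Field K] {Ψ : Type v} [MulSemiringAction (Equiv.Perm Ψ) K]

theorem exists_pointwiseFixer_smul_eq {V : Type w} [AddCommGroup V]
    [Module (SkewMonoidAlgebra K (Equiv.Perm Ψ)) V] (hV : IsSmoothModule K (Equiv.Perm Ψ) V)
    (x : V) : ∃ A : Finset Ψ, ∀ g ∈ pointwiseFixer A,
      SkewMonoidAlgebra.of K (Equiv.Perm Ψ) g • x = x := by
  obtain ⟨A, hA⟩ := exists_pointwiseFixer_coset_subset (hV x) (g := 1)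
    (show _ • x = x by rw [map_one, one_smul])
  exact ⟨A, fun g hg => by simpa using hA g hg⟩

theorem skewInclusion_single (U : Subgroup (Equiv.Perm Ψ)) (g : U) (a : K) :
    skewInclusion K U (SkewMonoidAlgebra.single g a) =
      SkewMonoidAlgebra.single (g : Equiv.Perm Ψ) a :=
  SkewMonoidAlgebra.mapDomain_single

theorem isSmoothModule_resSubgroup {V : Type w} [AddCommGroup V]
    [Module (SkewMonoidAlgebra K (Equiv.Perm Ψ)) V] (hV : IsSmoothModule K (Equiv.Perm Ψ) V)
    (U : Subgroup (Equiv.Perm Ψ)) : IsSmoothModule K U (ResSubgroup U V) := by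
  intro x
  have : {g : U | SkewMonoidAlgebra.of K U g • x = x} = Subtype.val ⁻¹'
      {g : Equiv.Perm Ψ | SkewMonoidAlgebra.of K (Equiv.Perm Ψ) g • (show V from x) = x} := by
    ext g
    have h : SkewMonoidAlgebra.of K U g • x =
        SkewMonoidAlgebra.of K (Equiv.Perm Ψ) g • (show V from x) :=
      congrArg (fun r : SkewMonoidAlgebra K (Equiv.Perm Ψ) => r • (show V from x))
        (skewInclusion_single U g 1)
    rw [Set.mem_ofPred_eq, h]
    rfl
  rw [this]
  exact (hV x).preimage continuous_subtype_val

theorem IsSmoothModule.submodule {G : Type v} [Group G] [TopologicalSpace G]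
    [MulSemiringAction G K] {V : Type w} [AddCommGroup V] [Module (SkewMonoidAlgebra K G) V]
    (hV : IsSmoothModule K G V) (W : Submodule (SkewMonoidAlgebra K G) V) :
    IsSmoothModule K G W := fun x => by
  simpa [Subtype.ext_iff] using hV x

/-- The kernel of a surjection onto a finitely generated module is a direct summand over every
sufficiently small stabilizer. -/
theorem exists_forall_isSmoothDirectSummand_ker [Infinite Ψ] [FaithfulSMul (Equiv.Perm Ψ) K]
    (hK : IsSmoothAction (Equiv.Perm Ψ) K) {X P : Type*}
    [AddCommGroup X] [Module (SkewMonoidAlgebra K (Equiv.Perm Ψ)) X]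
    (hX : IsSmoothModule K (Equiv.Perm Ψ) X)
    [AddCommGroup P] [Module (SkewMonoidAlgebra K (Equiv.Perm Ψ)) P]
    [Module.Finite (SkewMonoidAlgebra K (Equiv.Perm Ψ)) P]
    (f : X →ₗ[SkewMonoidAlgebra K (Equiv.Perm Ψ)] P) (hf : Function.Surjective f) :
    ∃ T : Finset Ψ, ∀ T', T ⊆ T' →
      IsSmoothDirectSummand (pointwiseFixer T') (LinearMap.ker f) := by
  classical
  let ι : K →+* SkewMonoidAlgebra K (Equiv.Perm Ψ) :=
    { toFun := fun a => SkewMonoidAlgebra.single 1 a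
      map_one' := rfl
      map_zero' := SkewMonoidAlgebra.single_zero _
      map_add' := fun a b => SkewMonoidAlgebra.single_add _ a b
      map_mul' := fun a b => by simp [SkewMonoidAlgebra.single_mul_single] }
  let o := SkewMonoidAlgebra.of K (Equiv.Perm Ψ)
  have hsingle : ∀ (g : Equiv.Perm Ψ) (a : K), SkewMonoidAlgebra.single g a = ι a * o g :=
    fun g a => by simp [ι, o, SkewMonoidAlgebra.single_mul_single]
  have hcomm : ∀ (g : Equiv.Perm Ψ) (a : K), o g * ι a = ι (g • a) * o g :=
    fun g a => by simp [ι, o, SkewMonoidAlgebra.single_mul_single]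
  let : Module K X := Module.compHom X ι
  let : Module K P := Module.compHom P ι
  let : DistribMulAction (Equiv.Perm Ψ) X := DistribMulAction.compHom X o
  let : DistribMulAction (Equiv.Perm Ψ) P := DistribMulAction.compHom P o
  have hXι : ∀ (a : K) (x : X), a • x = ι a • x := fun _ _ => rfl
  have hPι : ∀ (a : K) (x : P), a • x = ι a • x := fun _ _ => rfl
  have hXo : ∀ (g : Equiv.Perm Ψ) (x : X), g • x = o g • x := fun _ _ => rfl
  have hPo : ∀ (g : Equiv.Perm Ψ) (x : P), g • x = o g • x := fun _ _ => rfl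
  have : SMulDistribClass (Equiv.Perm Ψ) K X := ⟨fun g a x => by
    simp only [hXι, hXo, smul_smul, hcomm]⟩
  have : SMulDistribClass (Equiv.Perm Ψ) K P := ⟨fun g a x => by
    simp only [hPι, hPo, smul_smul, hcomm]⟩
  let π : X →ₗ[K] P :=
    { toFun := f
      map_add' := f.map_add
      map_smul' := fun a x => f.map_smul (ι a) x }
  have hπ : ∀ (g : Equiv.Perm Ψ) x, π (g • x) = g • π x := fun g x => f.map_smul (o g) x
  have hK' : ∀ a : K, ∃ A : Finset Ψ, ∀ g ∈ pointwiseFixer A, g • a = a := fun a => by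
    obtain ⟨A, hA⟩ := exists_pointwiseFixer_coset_subset (hK a) (g := 1) (one_mem _)
    exact ⟨A, fun g hg => by simpa using hA g hg⟩
  have hX' : ∀ x : X, ∃ A : Finset Ψ, ∀ g ∈ pointwiseFixer A, g • x = x :=
    exists_pointwiseFixer_smul_eq hX
  obtain ⟨S, hS⟩ := Module.Finite.fg_top (R := SkewMonoidAlgebra K (Equiv.Perm Ψ)) (M := P)
  have hP' : ∀ v : P, ∃ A : Finset Ψ, ∀ g ∈ pointwiseFixer A, g • v = v := fun v => by
    obtain ⟨x, rfl⟩ := hf v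
    obtain ⟨A, hA⟩ := hX' x
    exact ⟨A, fun g hg => (hπ g x).symm.trans (congrArg π (hA g hg))⟩
  choose supp hsupp using hP'
  let D : Finset Ψ → Set P := fun A =>
    {w | ∃ v ∈ S, ∃ g : Equiv.Perm Ψ, (supp v).map g.toEmbedding = A ∧ g • v = w}
  have hD : IsGeneratingFamily D ∅ :=
    { finite := fun A => by
        have : D A ⊆ ⋃ v ∈ S,
            {w | ∃ g : Equiv.Perm Ψ, (supp v).map g.toEmbedding = A ∧ g • v = w} := by
          rintro w ⟨v, hv, h⟩
          exact Set.mem_biUnion hv h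
        refine (S.finite_toSet.biUnion fun v _ => ?_).subset this
        -- The vector g • v depends only on g restricted to the support of v, so it is determined by
        -- one of finitely many maps into A.
        let h : {w | ∃ g : Equiv.Perm Ψ, (supp v).map g.toEmbedding = A ∧ g • v = w} →
            (supp v → A) := fun w x => ⟨w.2.choose x, by
              have := w.2.choose_spec.1
              exact this.subset (Finset.mem_map_of_mem _ x.2)⟩
        refine Set.finite_coe_iff.1 (Finite.of_injective h fun w w' hww' => Subtype.ext ?_)
        rw [← w.2.choose_spec.2, ← w'.2.choose_spec.2, ← inv_smul_eq_iff, smul_smul]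
        refine hsupp v _ (mem_pointwiseFixer.2 fun x hx => ?_)
        rw [Equiv.Perm.mul_apply, Equiv.Perm.inv_eq_iff_eq]
        exact congrArg Subtype.val (congrFun hww' ⟨x, hx⟩)
      smul_mem := by
        rintro g - _ _ ⟨v, hv, h, rfl, rfl⟩
        refine ⟨v, hv, g * h, ?_, mul_smul _ _ _⟩
        rw [Finset.map_map]
        rfl }
  have hspan : Submodule.span K {w | ∃ A, w ∈ D A} = ⊤ := by
    let W : Submodule (SkewMonoidAlgebra K (Equiv.Perm Ψ)) P :=
      { (Submodule.span K {w | ∃ A, w ∈ D A}).toAddSubmonoid with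
        smul_mem' := fun r w hw => by
          induction r using SkewMonoidAlgebra.induction_on with
          | zero => rw [zero_smul]; exact (Submodule.span K {w | ∃ A, w ∈ D A}).zero_mem
          | single g a =>
            rw [hsingle, mul_smul]
            refine Submodule.smul_mem (Submodule.span K {w | ∃ A, w ∈ D A}) a
              (smul_mem_span_of_forall (g := g) ?_ hw)
            rintro y ⟨A, hy⟩
            exact Submodule.subset_span ⟨_, hD.smul_mem g (mem_pointwiseFixer.2 (by simp)) A y hy⟩
          | add r r' hr hr' =>
            rw [add_smul]
            exact (Submodule.span K {w | ∃ A, w ∈ D A}).add_mem hr hr' }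
    have hW : W = ⊤ := top_le_iff.1 (hS ▸ Submodule.span_le.2 fun v hv =>
      Submodule.subset_span ⟨_, v, hv, 1, rfl, one_smul _ v⟩)
    exact eq_top_iff.2 fun x _ => (hW ▸ Submodule.mem_top : x ∈ W)
  -- The `+ 1` turns the maximal support size into the strict bound required; the initial T is
  -- empty.
  obtain ⟨T, C, -, hCG, hCinf, hCmap⟩ := exists_stable_lift hK' hX' π hπ
    (S.sup (fun v => (supp v).card) + 1) D ∅ hD (fun A v _ => hf v) (by
      rintro _ _ ⟨v, hv, g, rfl, rfl⟩
      rw [Finset.sdiff_empty, Finset.card_map]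
      exact Nat.lt_succ_of_le (Finset.le_sup (f := fun v => (supp v).card) hv))
  rw [hspan] at hCmap
  refine ⟨T, fun T' hT' => ?_⟩
  have hXU := isSmoothModule_resSubgroup hX (pointwiseFixer T')
  let W' : Submodule (SkewMonoidAlgebra K (pointwiseFixer T'))
      (ResSubgroup (pointwiseFixer T') X) :=
    { carrier := {x : X | x ∈ C}
      add_mem' := fun {_ _} hx hy => C.add_mem hx hy
      zero_mem' := C.zero_mem
      smul_mem' := fun r x hx => by
        change skewInclusion K (pointwiseFixer T') r • (show X from x) ∈ C
        induction r using SkewMonoidAlgebra.induction_on with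
        | zero => rw [map_zero, zero_smul]; exact C.zero_mem
        | single g a =>
          rw [skewInclusion_single, hsingle, mul_smul]
          exact C.smul_mem a (hCG g (pointwiseFixer_anti hT' g.2) x hx)
        | add r r' hr hr' => rw [map_add, add_smul]; exact C.add_mem hr hr' }
  refine ⟨hXU, hXU.submodule _, W', hXU.submodule _, ?_⟩
  rw [isCompl_iff, disjoint_iff, codisjoint_iff, eq_bot_iff, eq_top_iff]
  constructor
  · rintro x ⟨hx, hxC⟩
    have h : (show X from x) ∈ C ⊓ LinearMap.ker π := ⟨hxC, hx⟩
    rw [hCinf] at h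
    exact h
  · intro x _
    obtain ⟨y, hy, hyx⟩ : π x ∈ C.map π := hCmap ▸ Submodule.mem_top
    refine Submodule.mem_sup.2 ⟨(show X from x) - y, ?_, y, hy, sub_add_cancel (G := X) x y⟩
    change f ((show X from x) - y) = 0
    rw [map_sub]
    exact sub_eq_zero.2 hyx.symm

end SkewModules

theorem mainTheorem5 {Ψ : Type*} [Infinite Ψ] {K : Type*} [Field K]
    [MulSemiringAction (Equiv.Perm Ψ) K] [FaithfulSMul (Equiv.Perm Ψ) K]
    (hK : IsSmoothAction (Equiv.Perm Ψ) K)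
    {M' : Type*} [AddCommGroup M'] [Module (SkewMonoidAlgebra K (Equiv.Perm Ψ)) M']
    [Module.Finite (SkewMonoidAlgebra K (Equiv.Perm Ψ)) M']
    (hM' : IsSmoothModule K (Equiv.Perm Ψ) M')
    {M : Type*} [AddCommGroup M] [Module (SkewMonoidAlgebra K (Equiv.Perm Ψ)) M]
    [Module.Finite (SkewMonoidAlgebra K (Equiv.Perm Ψ)) M]
    (hM : IsSmoothModule K (Equiv.Perm Ψ) M)
    (φ : M' →ₗ[SkewMonoidAlgebra K (Equiv.Perm Ψ)] M) :
    ∃ U : Subgroup (Equiv.Perm Ψ), IsOpen (U : Set (Equiv.Perm Ψ)) ∧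
      IsSmoothDirectSummand U (LinearMap.ker φ) ∧
      IsSmoothDirectSummand U (LinearMap.range φ) := by
  -- The image of φ is finitely generated as a quotient of M'. Since each splitting persists for
  -- larger finite sets, T₁ ∪ T₂ serves both.
  obtain ⟨T₁, h₁⟩ := exists_forall_isSmoothDirectSummand_ker hK hM' φ.rangeRestrict
    φ.surjective_rangeRestrict
  obtain ⟨T₂, h₂⟩ := exists_forall_isSmoothDirectSummand_ker hK hM (LinearMap.range φ).mkQ
    (Submodule.mkQ_surjective _)
  classical
  refine ⟨pointwiseFixer (T₁ ∪ T₂), isOpen_pointwiseFixer _, ?_, ?_⟩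
  · simpa using h₁ _ Finset.subset_union_left
  · simpa using h₂ _ Finset.subset_union_right
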